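/- All graphs are finite and simple. For a graph $G$ and a vertex $v$, let $N[v]$ be the set consisting of $v$ and its neighbours, let $G_v = G - N[v]$ be the graph obtained by deleting $N[v]$, let $\alpha$ denote the independence number (with $\alpha=0$ for the graph with no vertices), and put $\alpha'(G)=\min\{\alpha(G_v) : v\in V(G)\}$. Let $K_{1,k}$ be the star with $k$ edges and $tK_{1,k}$ the disjoint union of $t$ copies of it. For graphs $G$ and $H$, the Ramsey number $r(G,H)$ is the smallest positive integer $N$ such that for every graph $F$ on $N$ vertices, $F$ contains $G$ as a (not necessarily induced) subgraph or the complement $\overline{F}$ contains $H$ as a subgraph. **Theorem.** Let $k\ge 1$, $t\ge 1$ and $n\ge 28t^2k^3$ be integers, and let $G$ be a connected graph with $n$ vertices and at most $n\left(1+\frac{1}{21tk-3k+6}\right)$ edges. Then $$r(G,tK_{1,k})\le \max\{n,\ n+k-1-\alpha'(G)\}+t-1.$$ In particular, if $\alpha'(G)\ge k-1$, then $r(G,tK_{1,k})=n+t-1$. -/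

import Mathlib

namespace SparseRamsey

/-- The graph `G_v = G - N[v]`, obtained from `G` by deleting `v` and all its neighbours. -/
def deleteClosedNbhd {V : Type*} (G : SimpleGraph V) (v : V) :
    SimpleGraph ((insert v (G.neighborSet v))ᶜ : Set V) :=
  G.induce ((insert v (G.neighborSet v))ᶜ : Set V)

/-- `α'(G)`, the minimum over all vertices `v` of the independence number of `G - N[v]`.
It is used for finite nonempty graphs, where the infimum is a minimum. -/
noncomputable def alphaPrime {V : Type*} (G : SimpleGraph V) : ℕ :=
  ⨅ v : V, (deleteClosedNbhd G v).indepNum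

/-- The star `K_{1,k}`. -/
def star (k : ℕ) : SimpleGraph (Fin 1 ⊕ Fin k) :=
  completeBipartiteGraph (Fin 1) (Fin k)

/-- `tH`, the disjoint union of `t` copies of the graph `H`. -/
def copies {W : Type*} (t : ℕ) (H : SimpleGraph W) : SimpleGraph (Fin t × W) where
  Adj p q := p.1 = q.1 ∧ H.Adj p.2 q.2
  symm := ⟨fun _ _ h => ⟨h.1.symm, h.2.symm⟩⟩
  loopless := ⟨fun p h => H.loopless.irrefl p.2 h.2⟩

/-- `N` is the Ramsey number `r(G, H)`: it is the smallest positive integer such that, for every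
graph `F` on `N` vertices, `G` is a (not necessarily induced) subgraph of `F` or `H` is a subgraph
of the complement of `F`. -/
def IsRamseyNumber {V W : Type*} (G : SimpleGraph V) (H : SimpleGraph W) (N : ℕ) : Prop :=
  IsLeast {m : ℕ | 0 < m ∧ ∀ F : SimpleGraph (Fin m), G.IsContained F ∨ H.IsContained Fᶜ} N

end SparseRamsey

namespace SparseRamsey

open Finset

/-! Write B for the complement of F. The task is to find tK_{1,k} in B, or to pack G with B: inject
V(G) into the vertices of B with no edge of G landing on an edge of B. The edge bound is used only
through 1/(21tk-3k+6) ≤ 1/24, so the average degree of G is at most 25/12.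

Induct on t. A vertex of B of degree at least t(k+1)-1 can be deleted: it still has k neighbours
outside any t-1 stars found in the rest. Otherwise B has maximum degree at most Δ = t(k+1)-2, and if
tK_{1,k} is missing, some y has degree below k in B (`exists_degree_lt_of_not_isContained`).

Now pack greedily in decreasing order of degree, which sparsity makes affordable (`greedy_cost_lt`),
and place a reserved independent set last by Hall's theorem. With few leaves, reserve vertices of
degree at most 2 whose neighbours also have degree at most 2. With many leaves spread over several
parents, reserve all leaves. If most leaves hang from one v₁, put v₁ on y, fill neighbours of y from
an independent set of G_{v₁}, and reserve the leaves of v₁; only here do deg y < k and α' matter.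

The matching lower bound takes F to be two disjoint cliques, of n-1 and at most t-1 vertices. -/

/-- `f` places the vertices in `P` injectively so that no edge of `G` inside `P` lands on an edge
of `B`. -/
def IsPartialPacking {V W : Type*} (G : SimpleGraph V) (B : SimpleGraph W) (P : Finset V)
    (f : V → W) : Prop :=
  Set.InjOn f P ∧ ∀ u ∈ P, ∀ v ∈ P, G.Adj u v → ¬ B.Adj (f u) (f v)

/-! ### Partial packings: greedy extension and completion by Hall's theorem. -/

section Packing

set_option linter.unusedSectionVars false

variable {V W : Type*} [DecidableEq V] [DecidableEq W]
  {G : SimpleGraph V} {B : SimpleGraph W} {P : Finset V} {f : V → W}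

theorem IsPartialPacking.insert_update (hf : IsPartialPacking G B P f) {w : V} (hw : w ∉ P) {x : W}
    (hx : x ∉ P.image f) (hadj : ∀ u ∈ P, G.Adj u w → ¬ B.Adj (f u) x) :
    IsPartialPacking G B (insert w P) (Function.update f w x) := by
  have hne : ∀ u ∈ P, u ≠ w := fun u hu h => hw (h ▸ hu)
  have hval : ∀ u ∈ P, Function.update f w x u = f u := fun u hu =>
    Function.update_of_ne (hne u hu) _ _
  have hfx : ∀ u ∈ P, f u ≠ x := fun u hu h => hx (mem_image.2 ⟨u, hu, h⟩)
  refine ⟨?_, ?_⟩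
  · intro u hu v hv huv
    rw [mem_coe, mem_insert] at hu hv
    rcases hu with rfl | hu <;> rcases hv with rfl | hv
    · rfl
    · rw [hval v hv, Function.update_self] at huv
      exact absurd huv.symm (hfx v hv)
    · rw [hval u hu, Function.update_self] at huv
      exact absurd huv (hfx u hu)
    · rw [hval v hv, hval u hu] at huv
      exact hf.1 hu hv huv
  · intro u hu v hv huv
    rw [mem_insert] at hu hv
    rcases hu with rfl | hu <;> rcases hv with rfl | hv
    · exact absurd huv (G.loopless.irrefl _)
    · rw [hval v hv, Function.update_self]
      exact fun h => hadj v hv huv.symm h.symm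
    · rw [hval u hu, Function.update_self]
      exact hadj u hu huv
    · rw [hval v hv, hval u hu]
      exact hf.2 u hu v hv huv

variable [Fintype V] [Fintype W] [DecidableRel G.Adj] [DecidableRel B.Adj] {Δ : ℕ}

/-- Greedy extension of a partial packing, placing vertices in decreasing order of `ρ`. -/
theorem IsPartialPacking.exists_extension (hB : ∀ x, B.degree x ≤ Δ) (ρ : V → ℕ)
    (Z : V → Finset W) (hf : IsPartialPacking G B P f) (R : Finset V) (hdisj : ∀ w ∈ R, w ∉ P)
    (hR : ∀ w ∈ R, ∀ S ⊆ R, w ∉ S → (∀ u ∈ S, ρ w ≤ ρ u) →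
      #(P ∪ S) + #(Z w) + #(G.neighborFinset w ∩ (P ∪ S)) * Δ < Fintype.card W) :
    ∃ g, IsPartialPacking G B (P ∪ R) g ∧ (∀ u ∈ P, g u = f u) ∧ ∀ w ∈ R, g w ∉ Z w := by
  induction R using Finset.induction_on_min_value ρ with
  | empty => exact ⟨f, by simpa using hf, fun _ _ => rfl, by simp⟩
  | insert w S hwS hmin ih =>
    obtain ⟨g, hg, hgf, hgZ⟩ := ih (fun v hv => hdisj v (mem_insert_of_mem hv))
      (fun v hv T hT => hR v (mem_insert_of_mem hv) T (hT.trans (subset_insert _ _)))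
    have hwP : w ∉ P := hdisj w (mem_insert_self _ _)
    have hcost := hR w (mem_insert_self _ _) S (subset_insert _ _) hwS hmin
    obtain ⟨x, hx⟩ : ∃ x, x ∉ ((P ∪ S).image g ∪ Z w) ∪
        (G.neighborFinset w ∩ (P ∪ S)).biUnion fun u => B.neighborFinset (g u) := by
      by_contra! hall
      have h1 : Fintype.card W ≤ #(((P ∪ S).image g ∪ Z w) ∪
          (G.neighborFinset w ∩ (P ∪ S)).biUnion fun u => B.neighborFinset (g u)) := by
        rw [← card_univ]
        exact card_le_card fun x _ => hall x
      have h2 : #((G.neighborFinset w ∩ (P ∪ S)).biUnion fun u => B.neighborFinset (g u)) ≤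
          #(G.neighborFinset w ∩ (P ∪ S)) * Δ :=
        card_biUnion_le_card_mul _ _ _ fun u _ => hB (g u)
      have h3 := card_union_le ((P ∪ S).image g ∪ Z w)
        ((G.neighborFinset w ∩ (P ∪ S)).biUnion fun u => B.neighborFinset (g u))
      have h4 := card_union_le ((P ∪ S).image g) (Z w)
      have h5 : #((P ∪ S).image g) ≤ #(P ∪ S) := card_image_le
      omega
    simp only [mem_union, not_or, mem_biUnion, not_exists, not_and] at hx
    have hwPS : w ∉ P ∪ S := by simp [hwP, hwS]
    have hne : ∀ u ∈ P ∪ S, u ≠ w := fun u hu h => hwPS (h ▸ hu)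
    refine ⟨Function.update g w x, ?_, ?_, ?_⟩
    · rw [union_insert]
      refine hg.insert_update hwPS hx.1.1 fun u hu huw hux => hx.2 u ?_ ?_
      · exact mem_inter.2 ⟨(G.mem_neighborFinset _ _).2 huw.symm, hu⟩
      · exact (B.mem_neighborFinset _ _).2 hux
    · intro u hu
      rw [Function.update_of_ne (hne u (mem_union_left _ hu)), hgf u hu]
    · intro v hv
      rcases mem_insert.1 hv with rfl | hv
      · rw [Function.update_self]
        exact hx.1.2
      · rw [Function.update_of_ne (hne v (mem_union_right _ hv))]
        exact hgZ v hv

/-- Completion of a partial packing on an independent set of remaining vertices by Hall's theorem.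
-/
theorem IsPartialPacking.exists_packing (hf : IsPartialPacking G B P f)
    (hI : ∀ u ∉ P, ∀ v ∉ P, ¬ G.Adj u v) (X : Finset W) (hX : ∀ x ∈ X, ∀ u ∈ P, f u ≠ x)
    (hcard : #Pᶜ ≤ #X) (a : ℕ)
    (ha : ∀ u ∉ P, #{x ∈ X | ∃ v ∈ P, G.Adj u v ∧ B.Adj (f v) x} ≤ a)
    (hb : ∀ x ∈ X, #{u ∈ Pᶜ | ∃ v ∈ P, G.Adj u v ∧ B.Adj (f v) x} + a ≤ #Pᶜ) :
    ∃ g : V → W, Function.Injective g ∧ ∀ u v, G.Adj u v → ¬ B.Adj (g u) (g v) := by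
  let N : {u // u ∈ Pᶜ} → Finset W := fun u =>
    {x ∈ X | ¬ ∃ v ∈ P, G.Adj u v ∧ B.Adj (f v) x}
  have hall : ∀ A : Finset {u // u ∈ Pᶜ}, #A ≤ #(A.biUnion N) := by
    intro A
    by_contra! hlt
    obtain ⟨u, hu⟩ : A.Nonempty := by
      rw [← card_pos]; omega
    have hA : #A ≤ #Pᶜ := by
      simpa only [Fintype.card_coe] using card_le_univ A
    have hsub : A.biUnion N ⊆ X := biUnion_subset.2 fun _ _ => filter_subset _ _
    -- A Hall violator `A` misses some place `x`, so all of `A` is blocked at `x` and `#A ≤ #Pᶜ -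
    -- a`; but one vertex of `A` alone already has at least `#X - a` free places.
    obtain ⟨x, hxX, hx⟩ : ∃ x ∈ X, x ∉ A.biUnion N := by
      by_contra! h
      have := card_le_card (show X ⊆ A.biUnion N from h)
      omega
    have h1 : #X ≤ #(A.biUnion N) + a := by
      have h2 := card_filter_add_card_filter_not (s := X)
        (fun x => ∃ v ∈ P, G.Adj u v ∧ B.Adj (f v) x)
      have h3 : #(N u) ≤ #(A.biUnion N) := card_le_card (subset_biUnion_of_mem N hu)
      have h4 := ha u (mem_compl.1 u.2)
      change _ + #(N u) = _ at h2
      omega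
    have h2 : #A ≤ #{u ∈ Pᶜ | ∃ v ∈ P, G.Adj u v ∧ B.Adj (f v) x} := by
      rw [← card_map (Function.Embedding.subtype _)]
      refine card_le_card fun y hy => ?_
      obtain ⟨w, hwA, rfl⟩ := mem_map.1 hy
      refine mem_filter.2 ⟨w.2, ?_⟩
      by_contra hcon
      exact hx (mem_biUnion.2 ⟨w, hwA, mem_filter.2 ⟨hxX, hcon⟩⟩)
    have := hb x hxX
    omega
  obtain ⟨e, he, heN⟩ := (all_card_le_biUnion_card_iff_exists_injective N).1 hall
  have heX : ∀ u, e u ∈ X := fun u => (mem_filter.1 (heN u)).1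
  have heB : ∀ u : {u // u ∈ Pᶜ}, ∀ v ∈ P, G.Adj u v → ¬ B.Adj (f v) (e u) := fun u v hv huv h =>
    (mem_filter.1 (heN u)).2 ⟨v, hv, huv, h⟩
  have hc : ∀ {u}, u ∉ P → u ∈ Pᶜ := fun h => mem_compl.2 h
  refine ⟨fun u => if h : u ∈ P then f u else e ⟨u, hc h⟩, ?_, ?_⟩
  · intro u v huv
    by_cases hu : u ∈ P <;> by_cases hv : v ∈ P <;> simp only [hu, hv, dite_true, dite_false] at huv
    · exact hf.1 hu hv huv
    · exact absurd huv (hX _ (heX _) u hu)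
    · exact absurd huv.symm (hX _ (heX _) v hv)
    · exact congrArg Subtype.val (he huv)
  · intro u v huv
    by_cases hu : u ∈ P <;> by_cases hv : v ∈ P <;> simp only [hu, hv, dite_true, dite_false]
    · exact hf.2 u hu v hv huv
    · exact heB ⟨v, hc hv⟩ u hu huv.symm
    · exact fun h => heB ⟨u, hc hu⟩ v hv huv h.symm
    · exact absurd huv (hI u hu v hv)

theorem card_blocked_places_le (hB : ∀ x, B.degree x ≤ Δ) (f : V → W) (P : Finset V)
    (X : Finset W) (u : V) :
    #{x ∈ X | ∃ v ∈ P, G.Adj u v ∧ B.Adj (f v) x} ≤ G.degree u * Δ := by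
  refine le_trans (card_le_card fun x hx => ?_)
    (card_biUnion_le_card_mul (G.neighborFinset u) (fun v => B.neighborFinset (f v)) Δ
      fun v _ => hB (f v))
  obtain ⟨-, v, -, huv, hvx⟩ := mem_filter.1 hx
  exact mem_biUnion.2 ⟨v, by simpa using huv, by simpa using hvx⟩

theorem card_blocked_vertices_le (hB : ∀ x, B.degree x ≤ Δ) (hf : Set.InjOn f P)
    (I : Finset V) (x : W) (c : ℕ)
    (hc : ∀ v ∈ P, B.Adj (f v) x → #(G.neighborFinset v ∩ I) ≤ c) :
    #{u ∈ I | ∃ v ∈ P, G.Adj u v ∧ B.Adj (f v) x} ≤ Δ * c := by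
  have h1 : #{v ∈ P | B.Adj (f v) x} ≤ Δ := by
    refine le_trans ?_ (hB x)
    refine card_le_card_of_injOn f (fun v hv => ?_) (hf.mono fun v hv => ?_)
    · simpa using (mem_filter.1 hv).2.symm
    · exact (mem_filter.1 hv).1
  refine le_trans (card_le_card fun u hu => ?_) ((card_biUnion_le_card_mul
    {v ∈ P | B.Adj (f v) x} (fun v => G.neighborFinset v ∩ I) c
      fun v hv => hc v (mem_filter.1 hv).1 (mem_filter.1 hv).2).trans (Nat.mul_le_mul_right c h1))
  obtain ⟨huI, v, hv, huv, hvx⟩ := mem_filter.1 hu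
  exact mem_biUnion.2 ⟨v, mem_filter.2 ⟨hv, hvx⟩, mem_inter.2 ⟨by simpa using huv.symm, huI⟩⟩

end Packing

/-! ### Numerical estimates from n ≥ 28t²k³. -/

/-- The greedy step for a vertex of degree `d`: `q` bounds the vertices of degree at least `d`, `s`
the earlier greedy placements, `r` the placed neighbours and `z` the forbidden places. With `m =
tk`, `Δ < 2m` and `28m²k ≤ n`, so `Δ²` is at most `n/7`. -/
theorem greedy_cost_lt {n k t Δ : ℕ} (hk : 1 ≤ k) (ht : 1 ≤ t) (hn : 28 * t ^ 2 * k ^ 3 ≤ n)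
    (hΔ : Δ + 2 ≤ t * (k + 1)) {d q s r z : ℕ} (hd : 3 ≤ d) (hq : 12 * ((d - 1) * q) ≤ 13 * n)
    (hs : s + 1 ≤ q) (hrd : r ≤ d) (hrs : r ≤ k + s) (hz : 7 * z ≤ n) :
    k + s + z + r * Δ < n := by
  obtain ⟨d, rfl⟩ : ∃ e, d = e + 1 := ⟨d - 1, by omega⟩
  rw [Nat.add_sub_cancel] at hq
  obtain ⟨m, hm⟩ : ∃ m, m = t * k := ⟨_, rfl⟩
  have hkm : k ≤ m := hm ▸ Nat.le_mul_of_pos_left k ht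
  have htm : t ≤ m := hm ▸ Nat.le_mul_of_pos_right t hk
  have hΔm : Δ + 2 ≤ 2 * m := by
    have : t * (k + 1) = m + t := by rw [hm]; ring
    omega
  have hnm : 28 * (m ^ 2 * k) ≤ n := by
    have : 28 * t ^ 2 * k ^ 3 = 28 * (m ^ 2 * k) := by rw [hm]; ring
    omega
  have h1 : m ^ 2 ≤ m ^ 2 * k := Nat.le_mul_of_pos_right _ hk
  have h2 : m * k ≤ m ^ 2 * k := by nlinarith [Nat.mul_le_mul_right (m * k) (hk.trans hkm)]
  have h3 : k ≤ m * k := Nat.le_mul_of_pos_left k (hk.trans hkm)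
  have h4 : Δ * Δ + 4 * Δ + 4 ≤ 4 * m ^ 2 := by nlinarith
  have h5 : k * Δ ≤ 2 * (m * k) := by nlinarith
  rcases Nat.lt_or_ge d 4 with hd4 | hd4
  · have h6 : 2 * q ≤ d * q := Nat.mul_le_mul_right q (by omega)
    have h7 : r * Δ ≤ 4 * Δ := Nat.mul_le_mul_right Δ (by omega)
    have h8 : 2 * m ≤ m ^ 2 + 1 := by zify; nlinarith [sq_nonneg ((m : ℤ) - 1)]
    omega
  · have h6 : 4 * q ≤ d * q := Nat.mul_le_mul_right q hd4
    rcases Nat.lt_or_ge k r with hr | hr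
    · obtain ⟨x, rfl⟩ : ∃ x, r = k + x := ⟨r - k, by omega⟩
      have h7 : x * x ≤ d * q := Nat.mul_le_mul (by omega) (by omega)
      -- Since `x` is bounded by both the degree and the number of earlier vertices, `x²` is at most
      -- `13n/12`; AM-GM with weight 3 balances this against `Δ²`.
      have h8 : 6 * (x * Δ) ≤ x * x + 9 * (Δ * Δ) := by
        zify; nlinarith [sq_nonneg ((x : ℤ) - 3 * Δ)]
      rw [Nat.add_mul]
      omega
    · have h7 : r * Δ ≤ k * Δ := Nat.mul_le_mul_right Δ hr
      omega

theorem leaf_threshold_le {n k t Δ L : ℕ} (hk : 1 ≤ k) (ht : 1 ≤ t)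
    (hn : 28 * t ^ 2 * k ^ 3 ≤ n) (hΔ : Δ + 2 ≤ t * (k + 1))
    (hL : L < Δ * Δ ∨ L < 5 * Δ + k) : 12 * L + 36 * Δ ≤ 2 * n := by
  obtain ⟨m, hm⟩ : ∃ m, m = t * k := ⟨_, rfl⟩
  have hkm : k ≤ m := hm ▸ Nat.le_mul_of_pos_left k ht
  have htm : t ≤ m := hm ▸ Nat.le_mul_of_pos_right t hk
  have hΔm : Δ + 2 ≤ 2 * m := by
    have : t * (k + 1) = m + t := by rw [hm]; ring
    omega
  have hnm : 28 * (m ^ 2 * k) ≤ n := by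
    have : 28 * t ^ 2 * k ^ 3 = 28 * (m ^ 2 * k) := by rw [hm]; ring
    omega
  have h1 : m ^ 2 ≤ m ^ 2 * k := Nat.le_mul_of_pos_right _ hk
  rcases hL with hL | hL
  · have h4 : Δ * Δ + 4 * Δ + 4 ≤ 4 * m ^ 2 := by nlinarith
    omega
  · have h2 : 204 * m ≤ 56 * m ^ 2 + 192 := by
      zify; nlinarith [sq_nonneg (28 * (m : ℤ) - 51)]
    omega

theorem sq_degree_bound_le {n k t Δ : ℕ} (hk : 1 ≤ k) (ht : 1 ≤ t)
    (hn : 28 * t ^ 2 * k ^ 3 ≤ n) (hΔ : Δ + 2 ≤ t * (k + 1)) :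
    7 * (Δ * Δ) ≤ n ∧ 7 * k ≤ n ∧ 28 ≤ n ∧ (t - 1) * (k + 1) * (Δ + 1) < n := by
  obtain ⟨m, hm⟩ : ∃ m, m = t * k := ⟨_, rfl⟩
  have hkm : k ≤ m := hm ▸ Nat.le_mul_of_pos_left k ht
  have htm : t ≤ m := hm ▸ Nat.le_mul_of_pos_right t hk
  have htk : t * (k + 1) = m + t := by rw [hm]; ring
  have hΔm : Δ + 2 ≤ 2 * m := by omega
  have hnm : 28 * (m ^ 2 * k) ≤ n := by
    have : 28 * t ^ 2 * k ^ 3 = 28 * (m ^ 2 * k) := by rw [hm]; ring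
    omega
  have h1 : m ^ 2 ≤ m ^ 2 * k := Nat.le_mul_of_pos_right _ hk
  have h2 : m ≤ m ^ 2 := by nlinarith
  have h3 : (t - 1) * (k + 1) ≤ 2 * m :=
    (Nat.mul_le_mul_right _ (Nat.sub_le t 1)).trans (by omega)
  have h4 : (t - 1) * (k + 1) * (Δ + 1) ≤ 2 * m * (2 * m) := Nat.mul_le_mul h3 (by omega)
  have h5 : Δ * Δ ≤ 2 * m * (2 * m) := Nat.mul_le_mul (by omega) (by omega)
  have h6 : 2 * m * (2 * m) = 4 * m ^ 2 := by ring
  omega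

/-! ### Degree counting in a sparse graph. -/

section Counting

set_option linter.unusedSectionVars false

variable {V W : Type*} [DecidableEq V] [DecidableEq W] [Fintype V] [Fintype W]
  {G : SimpleGraph V} {B : SimpleGraph W} [DecidableRel G.Adj] [DecidableRel B.Adj]
  {P : Finset V} {f : V → W} {k t Δ : ℕ}

/-- Every degree is at least 1, so the total excess over 1 is at most 13n/12, and each counted
vertex contributes at least `d - 1` to it. -/
theorem card_degree_ge_le (hpos : ∀ v, 1 ≤ G.degree v)
    (hsum : 12 * ∑ v, G.degree v ≤ 25 * Fintype.card V) {d : ℕ} (hd : 1 ≤ d) :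
    12 * ((d - 1) * #{v | d ≤ G.degree v}) ≤ 13 * Fintype.card V := by
  have h1 : Fintype.card V + (d - 1) * #{v | d ≤ G.degree v} ≤ ∑ v, G.degree v := by
    have h2 : ∑ v, (1 + if d ≤ G.degree v then d - 1 else 0) ≤ ∑ v, G.degree v := by
      refine sum_le_sum fun v _ => ?_
      have := hpos v
      split_ifs <;> omega
    rw [sum_add_distrib, ← sum_filter, sum_const, sum_const, card_univ] at h2
    simpa [mul_comm] using h2
  omega

/-- Excluded vertices lie in closed neighbourhoods of vertices of degree at least 3, whose sizes are
summed using the degree sum. -/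
theorem card_not_low_degree_nbhd_le (hpos : ∀ v, 1 ≤ G.degree v)
    (hsum : 12 * ∑ v, G.degree v ≤ 25 * Fintype.card V) :
    3 * #{v | ¬ (G.degree v ≤ 2 ∧ ∀ u, G.Adj v u → G.degree u ≤ 2)} ≤
      Fintype.card V + 12 * #{v | G.degree v = 1} := by
  have h1 : #{v | ¬ (G.degree v ≤ 2 ∧ ∀ u, G.Adj v u → G.degree u ≤ 2)} ≤
      ∑ v with 3 ≤ G.degree v, (G.degree v + 1) := by
    refine le_trans (card_le_card (t := ({v | 3 ≤ G.degree v} : Finset V).biUnion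
      fun v => insert v (G.neighborFinset v)) fun v hv => ?_) (card_biUnion_le.trans ?_)
    · rw [mem_filter] at hv
      rw [mem_biUnion]
      by_cases h : G.degree v ≤ 2
      · have := hv.2
        push Not at this
        obtain ⟨u, huv, hu⟩ := this h
        exact ⟨u, mem_filter.2 ⟨mem_univ _, hu⟩, by simp [huv.symm]⟩
      · exact ⟨v, by simp; omega, mem_insert_self _ _⟩
    · exact sum_le_sum fun v _ => card_insert_le _ _
  -- Pointwise, `[d ≥ 3](d + 1) + 8 ≤ 4d + 4[d = 1]` for `d ≥ 1`, with equality at 1, 2 and 3.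
  have h2 : ∑ v with 3 ≤ G.degree v, (G.degree v + 1) + 8 * Fintype.card V ≤
      4 * ∑ v, G.degree v + 4 * #{v | G.degree v = 1} := by
    rw [sum_filter, card_filter, mul_sum, mul_sum, ← card_univ, card_eq_sum_ones, mul_sum,
      ← sum_add_distrib, ← sum_add_distrib]
    refine sum_le_sum fun v _ => ?_
    have := hpos v
    split_ifs <;> omega
  omega

/-- Greedy choice: each chosen vertex discards at most three vertices, itself included. -/
theorem exists_independent_third (K : Finset V) (hK : ∀ v ∈ K, G.degree v ≤ 2) :
    ∃ I ⊆ K, (∀ u ∈ I, ∀ v ∈ I, ¬ G.Adj u v) ∧ #K ≤ 3 * #I := by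
  induction K using Finset.strongInduction with
  | H K ih =>
    rcases K.eq_empty_or_nonempty with rfl | ⟨v, hv⟩
    · exact ⟨∅, Subset.rfl, by simp, by simp⟩
    · have hlt : K \ insert v (G.neighborFinset v) ⊂ K :=
        ⟨sdiff_subset, fun h => by simpa using h hv⟩
      obtain ⟨I, hI, hind, hcard⟩ := ih _ hlt fun u hu => hK u (sdiff_subset hu)
      have hvI : ∀ u ∈ I, ¬ G.Adj v u ∧ u ≠ v := fun u hu => by
        have := hI hu
        simp only [mem_sdiff, mem_insert, SimpleGraph.mem_neighborFinset, not_or] at this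
        exact ⟨this.2.2, this.2.1⟩
      refine ⟨insert v I, insert_subset hv (hI.trans sdiff_subset), ?_, ?_⟩
      · intro x hx' y hy' hxy
        rcases mem_insert.1 hx' with rfl | hx <;> rcases mem_insert.1 hy' with rfl | hy
        · exact G.loopless.irrefl _ hxy
        · exact (hvI y hy).1 hxy
        · exact (hvI x hx).1 hxy.symm
        · exact hind x hx y hy hxy
      · have h1 : #(insert v I) = #I + 1 := card_insert_of_notMem fun h => (hvI v h).2 rfl
        have h2 : #K ≤ #(K \ insert v (G.neighborFinset v)) + #(insert v (G.neighborFinset v)) := by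
          have := card_le_card_sdiff_add_card (t := insert v (G.neighborFinset v)) (s := K)
          omega
        have h3 : #(insert v (G.neighborFinset v)) ≤ G.degree v + 1 := card_insert_le _ _
        have := hK v hv
        omega

theorem IsPartialPacking.exists_extension_of_sparse (hk : 1 ≤ k) (ht : 1 ≤ t)
    (hn : 28 * t ^ 2 * k ^ 3 ≤ Fintype.card V) (hΔ : Δ + 2 ≤ t * (k + 1))
    (hpos : ∀ v, 1 ≤ G.degree v) (hsum : 12 * ∑ v, G.degree v ≤ 25 * Fintype.card V)
    (hB : ∀ x, B.degree x ≤ Δ) (hW : Fintype.card V ≤ Fintype.card W)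
    (Z : V → Finset W) (hf : IsPartialPacking G B P f) (hP : #P ≤ k) (R : Finset V)
    (hdisj : ∀ w ∈ R, w ∉ P) (hZ : ∀ w ∈ R, 3 ≤ G.degree w → 7 * #(Z w) ≤ Fintype.card V)
    (hlow : ∀ w ∈ R, G.degree w ≤ 2 → #(P ∪ R) + #(Z w) + 2 * Δ ≤ Fintype.card W) :
    ∃ g, IsPartialPacking G B (P ∪ R) g ∧ (∀ u ∈ P, g u = f u) ∧ ∀ w ∈ R, g w ∉ Z w := by
  refine hf.exists_extension hB (fun v => G.degree v) Z R hdisj fun w hw S hSR hwS hS => ?_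
  have hrd : #(G.neighborFinset w ∩ (P ∪ S)) ≤ G.degree w := card_le_card inter_subset_left
  rcases Nat.lt_or_ge (G.degree w) 3 with h | h
  · have h1 := hlow w hw (by omega)
    have h2 : #(P ∪ S) < #(P ∪ R) := by
      refine card_lt_card ⟨union_subset_union_right hSR, fun hsub => ?_⟩
      rcases mem_union.1 (hsub (mem_union_right _ hw)) with h' | h'
      · exact hdisj w hw h'
      · exact hwS h'
    have h3 : #(G.neighborFinset w ∩ (P ∪ S)) * Δ ≤ 2 * Δ := Nat.mul_le_mul_right Δ (by omega)
    omega
  · have h1 : #S + 1 ≤ #{v | G.degree w ≤ G.degree v} := by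
      rw [← card_insert_of_notMem hwS]
      refine card_le_card fun u hu => ?_
      rcases mem_insert.1 hu with rfl | hu
      · simp
      · simpa using hS u hu
    have h2 : #(P ∪ S) ≤ #P + #S := card_union_le _ _
    have h3 : #(G.neighborFinset w ∩ (P ∪ S)) ≤ #(P ∪ S) := card_le_card inter_subset_right
    have := greedy_cost_lt hk ht hn hΔ h (card_degree_ge_le hpos hsum (by omega)) h1 hrd
      (by omega) (hZ w hw h)
    omega

end Counting

/-! ### The three cases of the packing, according to the leaves of G. -/

section Cases

set_option linter.unusedSectionVars false

variable {V W : Type*} [DecidableEq V] [DecidableEq W] [Fintype V] [Fintype W]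
  {G : SimpleGraph V} {B : SimpleGraph W} [DecidableRel G.Adj] [DecidableRel B.Adj]
  {k t Δ : ℕ}

/-- The reserved set has at least 4Δ vertices. Each is blocked at no more than 2Δ places and each
place blocks no more than 2Δ of them, so Hall's condition holds. -/
theorem exists_packing_of_few_leaves (hk : 1 ≤ k) (ht : 1 ≤ t)
    (hn : 28 * t ^ 2 * k ^ 3 ≤ Fintype.card V) (hΔ : Δ + 2 ≤ t * (k + 1))
    (hpos : ∀ v, 1 ≤ G.degree v) (hsum : 12 * ∑ v, G.degree v ≤ 25 * Fintype.card V)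
    (hB : ∀ x, B.degree x ≤ Δ) (hW : Fintype.card V ≤ Fintype.card W)
    (hL : #{v | G.degree v = 1} < Δ * Δ ∨ #{v | G.degree v = 1} < 5 * Δ + k) :
    ∃ g : V → W, Function.Injective g ∧ ∀ u v, G.Adj u v → ¬ B.Adj (g u) (g v) := by
  obtain ⟨I, hIK, hI, hcard⟩ := exists_independent_third (G := G)
    {v | G.degree v ≤ 2 ∧ ∀ u, G.Adj v u → G.degree u ≤ 2}
    fun v hv => (mem_filter.1 hv).2.1
  have hIdeg : ∀ u ∈ I, G.degree u ≤ 2 ∧ ∀ v, G.Adj u v → G.degree v ≤ 2 := fun u hu =>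
    (mem_filter.1 (hIK hu)).2
  have h28 := (sq_degree_bound_le hk ht hn hΔ).2.2.1
  have hI4 : 4 * Δ ≤ #I := by
    have h1 := card_not_low_degree_nbhd_le hpos hsum
    have h2 := leaf_threshold_le hk ht hn hΔ hL
    have h3 := card_filter_add_card_filter_not (s := (univ : Finset V))
      (fun v => G.degree v ≤ 2 ∧ ∀ u, G.Adj v u → G.degree u ≤ 2)
    rw [card_univ] at h3
    omega
  have hIc : #Iᶜ + #I = Fintype.card V := by rw [add_comm, card_add_card_compl]
  obtain ⟨y⟩ : Nonempty W := Fintype.card_pos_iff.1 (by omega)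
  have hf : IsPartialPacking G B ∅ (fun _ : V => y) := ⟨by simp, by simp⟩
  obtain ⟨g, hg, -, -⟩ := hf.exists_extension_of_sparse hk ht hn hΔ hpos hsum hB hW (fun _ => ∅)
    (by simp) Iᶜ (by simp) (by simp) (fun w _ _ => by rw [empty_union, card_empty]; omega)
  rw [empty_union] at hg
  refine hg.exists_packing (fun u hu v hv => hI u (by simpa using hu) v (by simpa using hv))
    (Iᶜ.image g)ᶜ (fun x hx u hu h => ?_) ?_ (2 * Δ) (fun u hu => ?_) (fun x _ => ?_)
  · exact mem_compl.1 hx (mem_image.2 ⟨u, hu, h⟩)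
  · have h1 : #(Iᶜ.image g) ≤ #Iᶜ := card_image_le
    have h2 := card_add_card_compl (Iᶜ.image g)
    rw [compl_compl]
    omega
  · exact (card_blocked_places_le hB g _ _ u).trans
      (Nat.mul_le_mul_right Δ (hIdeg u (by simpa using hu)).1)
  · have h1 := card_blocked_vertices_le (G := G) hB hg.1 (Iᶜ)ᶜ x 2 fun v _ _ => by
      rw [compl_compl]
      rcases (G.neighborFinset v ∩ I).eq_empty_or_nonempty with h | ⟨u, hu⟩
      · simp [h]
      · rw [mem_inter, SimpleGraph.mem_neighborFinset] at hu
        exact (card_le_card inter_subset_left).trans ((hIdeg u hu.2).2 v hu.1.symm)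
    rw [compl_compl] at h1 ⊢
    omega

/-- A leaf is blocked at no more than Δ places, so Hall needs every place to leave at least Δ leaves
unblocked. The danger is a neighbour of the place `y` of `v₁`, which blocks all leaves at `v₁`. -/
theorem exists_packing_of_spread_leaves (hk : 1 ≤ k) (ht : 1 ≤ t)
    (hn : 28 * t ^ 2 * k ^ 3 ≤ Fintype.card V) (hΔ : Δ + 2 ≤ t * (k + 1))
    (hpos : ∀ v, 1 ≤ G.degree v) (hsum : 12 * ∑ v, G.degree v ≤ 25 * Fintype.card V)
    (hB : ∀ x, B.degree x ≤ Δ) (hW : Fintype.card V ≤ Fintype.card W)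
    (hleaf : ∀ u v, G.degree u = 1 → G.degree v = 1 → ¬ G.Adj u v)
    (h2Δ : 2 * Δ ≤ #{v | G.degree v = 1}) (hΔ2 : Δ * Δ ≤ #{v | G.degree v = 1}) (v₁ : V)
    (hv₁ : G.degree v₁ ≠ 1)
    (hmax : ∀ v, #(G.neighborFinset v ∩ ({v | G.degree v = 1} : Finset V)) ≤
      #(G.neighborFinset v₁ ∩ ({v | G.degree v = 1} : Finset V)))
    (hspread : #(G.neighborFinset v₁ ∩ ({v | G.degree v = 1} : Finset V)) + 3 * Δ ≤
      #{v | G.degree v = 1}) :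
    ∃ g : V → W, Function.Injective g ∧ ∀ u v, G.Adj u v → ¬ B.Adj (g u) (g v) := by
  set L : Finset V := {v | G.degree v = 1} with hLdef
  have hmem : ∀ u, u ∈ L ↔ G.degree u = 1 := fun u => by simp [hLdef]
  have h28 := sq_degree_bound_le hk ht hn hΔ
  have hLc : #Lᶜ + #L = Fintype.card V := by rw [add_comm, card_add_card_compl]
  obtain ⟨y⟩ : Nonempty W := Fintype.card_pos_iff.1 (by omega)
  have hf : IsPartialPacking G B {v₁} (fun _ : V => y) :=
    ⟨by simp, fun u _ v _ _ => B.loopless.irrefl y⟩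
  -- Keeping degrees of 3 or more off the second neighbourhood of `y` ensures that, at a neighbour
  -- of `y`, parents other than `v₁` block at most 2Δ leaves.
  let Z : V → Finset W := fun w =>
    if 3 ≤ G.degree w then (B.neighborFinset y).biUnion fun x => B.neighborFinset x else ∅
  have hunion : {v₁} ∪ Lᶜ.erase v₁ = Lᶜ := by
    rw [← insert_eq, insert_erase (by simpa [hmem] using hv₁)]
  have hZhigh : ∀ w, 3 ≤ G.degree w → 7 * #(Z w) ≤ Fintype.card V := fun w hw => by
    have h1 : #(Z w) ≤ #(B.neighborFinset y) * Δ := by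
      simp only [Z, hw, if_true]
      exact card_biUnion_le_card_mul _ _ _ fun x _ => hB x
    have h2 : #(B.neighborFinset y) * Δ ≤ Δ * Δ := Nat.mul_le_mul_right Δ (hB y)
    omega
  obtain ⟨g, hg, hgv, hgZ⟩ := hf.exists_extension_of_sparse hk ht hn hΔ hpos hsum hB hW Z
    (by simpa using hk) (Lᶜ.erase v₁) (fun w hw h => (mem_erase.1 hw).1 (mem_singleton.1 h))
    (fun w _ => hZhigh w) (fun w _ hw => by
      have : ¬ 3 ≤ G.degree w := by omega
      simp only [Z, hunion, this, if_false, card_empty]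
      omega)
  rw [hunion] at hg
  have hgv₁ : g v₁ = y := hgv v₁ (mem_singleton_self _)
  have hv₁L : v₁ ∈ Lᶜ := by simpa [hmem] using hv₁
  refine hg.exists_packing (fun u hu v hv => hleaf u v ?_ ?_)
    (Lᶜ.image g)ᶜ (fun x hx u hu h => ?_) ?_ Δ (fun u hu => ?_) (fun x _ => ?_)
  · simpa [hmem] using hu
  · simpa [hmem] using hv
  · exact mem_compl.1 hx (mem_image.2 ⟨u, hu, h⟩)
  · have h1 : #(Lᶜ.image g) ≤ #Lᶜ := card_image_le
    have h2 := card_add_card_compl (Lᶜ.image g)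
    rw [compl_compl]
    omega
  · refine (card_blocked_places_le hB g _ _ u).trans ?_
    rw [show G.degree u = 1 by simpa [hmem] using hu, one_mul]
  · rw [compl_compl]
    by_cases hxy : B.Adj y x
    · have h1 : #{u ∈ L | ∃ v ∈ Lᶜ.erase v₁, G.Adj u v ∧ B.Adj (g v) x} ≤ Δ * 2 := by
        refine card_blocked_vertices_le hB (hg.1.mono (erase_subset _ _)) L x 2 fun v hv hvx => ?_
        refine (card_le_card inter_subset_left).trans ?_
        rw [SimpleGraph.card_neighborFinset_eq_degree]
        by_contra! h3
        refine hgZ v hv ?_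
        have h3' : 3 ≤ G.degree v := h3
        simp only [Z, h3', if_true, mem_biUnion, SimpleGraph.mem_neighborFinset]
        exact ⟨x, hxy, hvx.symm⟩
      have h2 : {u ∈ L | ∃ v ∈ Lᶜ, G.Adj u v ∧ B.Adj (g v) x} ⊆ (G.neighborFinset v₁ ∩ L) ∪
          {u ∈ L | ∃ v ∈ Lᶜ.erase v₁, G.Adj u v ∧ B.Adj (g v) x} := by
        intro u hu
        obtain ⟨huL, v, hv, huv, hvx⟩ := mem_filter.1 hu
        by_cases h : v = v₁
        · subst h
          exact mem_union_left _ (mem_inter.2 ⟨by simpa using huv.symm, huL⟩)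
        · exact mem_union_right _ (mem_filter.2 ⟨huL, v, mem_erase.2 ⟨h, hv⟩, huv, hvx⟩)
      have h3 := (card_le_card h2).trans (card_union_le _ _)
      omega
    · have h1 := card_blocked_vertices_le hB hg.1 L x _ fun v _ _ => hmax v
      -- Off the neighbourhood of `y`: either every parent has fewer than Δ leaves and `Δ²` leaves
      -- suffice, or the Δ or more leaves at `v₁` are themselves unblocked.
      rcases Nat.lt_or_ge #(G.neighborFinset v₁ ∩ L) Δ with hlt | hge
      · have h2 : Δ * (#(G.neighborFinset v₁ ∩ L) + 1) ≤ Δ * Δ := Nat.mul_le_mul_left Δ hlt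
        rw [mul_add, mul_one] at h2
        omega
      · have h2 : {u ∈ L | ∃ v ∈ Lᶜ, G.Adj u v ∧ B.Adj (g v) x} ⊆ L \ (G.neighborFinset v₁ ∩ L) := by
          intro u hu
          obtain ⟨huL, v, hv, huv, hvx⟩ := mem_filter.1 hu
          refine mem_sdiff.2 ⟨huL, fun hu₁ => hxy ?_⟩
          have hu₁' : G.Adj u v₁ :=
            ((G.mem_neighborFinset _ _).1 (mem_inter.1 hu₁).1).symm
          have : v = v₁ := by
            obtain ⟨w, hw⟩ := (G.degree_eq_one_iff_existsUnique_adj).1 ((hmem u).1 huL)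
            rw [hw.2 v huv, hw.2 v₁ hu₁']
          rw [← hgv₁, ← this]
          exact hvx
        have h3 := card_le_card h2
        have h4 := card_sdiff_add_card_eq_card (inter_subset_right : G.neighborFinset v₁ ∩ L ⊆ L)
        omega

/-- The reserved leaves see only `v₁`, so with `v₁` on `y` they fit anywhere off the neighbours of
`y`. Vertices of `J` use up as many of those neighbours as possible; the rest stay empty, and `hJy`
says there is room to waste them. -/
theorem exists_packing_of_concentrated_leaves (hk : 1 ≤ k) (ht : 1 ≤ t)
    (hn : 28 * t ^ 2 * k ^ 3 ≤ Fintype.card V) (hΔ : Δ + 2 ≤ t * (k + 1))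
    (hpos : ∀ v, 1 ≤ G.degree v) (hsum : 12 * ∑ v, G.degree v ≤ 25 * Fintype.card V)
    (hB : ∀ x, B.degree x ≤ Δ) (hW : Fintype.card V ≤ Fintype.card W) (v₁ : V)
    (hv₁ : 2 * Δ + k ≤ #(G.neighborFinset v₁ ∩ ({v | G.degree v = 1} : Finset V)))
    (J : Finset V) (hJ : ∀ u ∈ J, ∀ v ∈ J, ¬ G.Adj u v) (hJv₁ : ∀ u ∈ J, u ≠ v₁ ∧ ¬ G.Adj v₁ u)
    (y : W) (hy : B.degree y < k) (hJy : Fintype.card V + B.degree y ≤ Fintype.card W + #J) :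
    ∃ g : V → W, Function.Injective g ∧ ∀ u v, G.Adj u v → ¬ B.Adj (g u) (g v) := by
  set L : Finset V := G.neighborFinset v₁ ∩ ({v | G.degree v = 1} : Finset V) with hLdef
  have hL₁ : ∀ u ∈ L, ∀ v, G.Adj u v → v = v₁ := by
    intro u hu v huv
    simp only [hLdef, mem_inter, SimpleGraph.mem_neighborFinset, mem_filter, mem_univ,
      true_and] at hu
    obtain ⟨w, hw⟩ := (G.degree_eq_one_iff_existsUnique_adj).1 hu.2
    rw [hw.2 v huv, hw.2 v₁ hu.1.symm]
  have hLadj : ∀ u ∈ L, G.Adj v₁ u := fun u hu => by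
    simpa using (mem_inter.1 hu).1
  have h28 := sq_degree_bound_le hk ht hn hΔ
  have hLc : #Lᶜ + #L = Fintype.card V := by rw [add_comm, card_add_card_compl]
  obtain ⟨J', hJ'J, hJ'card⟩ := exists_subset_card_eq (min_le_left #J (B.degree y))
  obtain ⟨Y, hYy, hYcard⟩ := exists_subset_card_eq
    (s := B.neighborFinset y) (min_le_right #J (B.degree y))
  let e : J' ≃ Y := equivOfCardEq (hJ'card.trans hYcard.symm)
  have hyY : y ∉ Y := fun h => by simpa using hYy h
  have hv₁J : v₁ ∉ J' := fun h => (hJv₁ v₁ (hJ'J h)).1 rfl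
  let f : V → W := fun v => if h : v ∈ J' then e ⟨v, h⟩ else y
  have hfv₁ : f v₁ = y := by simp [f, hv₁J]
  have hfJ : ∀ v (h : v ∈ J'), f v = e ⟨v, h⟩ := fun v h => by simp [f, h]
  have hfY : ∀ v ∈ J', f v ∈ Y := fun v h => by rw [hfJ v h]; exact (e ⟨v, h⟩).2
  have hf : IsPartialPacking G B (insert v₁ J') f := by
    refine ⟨?_, ?_⟩
    · intro u hu v hv huv
      rw [mem_coe, mem_insert] at hu hv
      rcases hu with rfl | hu <;> rcases hv with rfl | hv
      · rfl
      · rw [hfv₁] at huv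
        exact absurd (huv ▸ hfY v hv) hyY
      · rw [hfv₁] at huv
        exact absurd (huv ▸ hfY u hu) hyY
      · rw [hfJ u hu, hfJ v hv] at huv
        exact congrArg Subtype.val (e.injective (Subtype.ext huv))
    · intro u hu v hv huv
      exfalso
      rw [mem_insert] at hu hv
      rcases hu with rfl | hu <;> rcases hv with rfl | hv
      · exact G.loopless.irrefl _ huv
      · exact (hJv₁ v (hJ'J hv)).2 huv
      · exact (hJv₁ u (hJ'J hu)).2 huv.symm
      · exact hJ u (hJ'J hu) v (hJ'J hv) huv
  have hPL : insert v₁ J' ⊆ Lᶜ := by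
    intro u hu
    rw [mem_compl]
    intro huL
    rcases mem_insert.1 hu with rfl | hu
    · exact G.loopless.irrefl _ (hLadj _ huL)
    · exact (hJv₁ u (hJ'J hu)).2 (hLadj _ huL)
  have hunion : insert v₁ J' ∪ (Lᶜ \ insert v₁ J') = Lᶜ := union_sdiff_of_subset hPL
  have hZ : #(B.neighborFinset y \ Y) + #Y = B.degree y := card_sdiff_add_card_eq_card hYy
  have hmin : #Y = #J ∨ #Y = B.degree y := by omega
  obtain ⟨g, hg, hgf, hgZ⟩ := hf.exists_extension_of_sparse hk ht hn hΔ hpos hsum hB hW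
    (fun _ => B.neighborFinset y \ Y)
    (by rw [card_insert_of_notMem hv₁J]; omega) (Lᶜ \ insert v₁ J')
    (fun w hw => (mem_sdiff.1 hw).2) (fun w _ hw => by omega)
    (fun w _ hw => by rw [hunion]; omega)
  rw [hunion] at hg
  have hgv₁ : g v₁ = y := (hgf v₁ (mem_insert_self _ _)).trans hfv₁
  have hgY : ∀ x ∈ Y, ∃ v ∈ Lᶜ, g v = x := by
    intro x hx
    have hu : ((e.symm ⟨x, hx⟩ : J') : V) ∈ J' := (e.symm ⟨x, hx⟩).2
    refine ⟨(e.symm ⟨x, hx⟩ : J'), hPL (mem_insert_of_mem hu), ?_⟩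
    rw [hgf _ (mem_insert_of_mem hu), hfJ _ hu]
    simp
  have hbad : ∀ u ∉ Lᶜ, ∀ x ∈ (Lᶜ.image g ∪ (B.neighborFinset y \ Y))ᶜ,
      ¬ ∃ v ∈ Lᶜ, G.Adj u v ∧ B.Adj (g v) x := by
    rintro u hu x hx ⟨v, hv, huv, hvx⟩
    rw [hL₁ u (by simpa using hu) v huv, hgv₁] at hvx
    rw [mem_compl, mem_union, not_or] at hx
    by_cases hxY : x ∈ Y
    · obtain ⟨w, hw, rfl⟩ := hgY x hxY
      exact hx.1 (mem_image_of_mem g hw)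
    · exact hx.2 (mem_sdiff.2 ⟨by simpa using hvx, hxY⟩)
  -- No remaining place blocks a remaining leaf, hence the Hall parameter 0.
  refine hg.exists_packing (fun u hu v hv huv => ?_)
    (Lᶜ.image g ∪ (B.neighborFinset y \ Y))ᶜ (fun x hx u hu h => ?_) ?_ 0 (fun u hu => ?_)
    (fun x hx => ?_)
  · rw [hL₁ u (by simpa using hu) v huv] at hv
    exact hv (hPL (mem_insert_self _ _))
  · exact mem_compl.1 hx (mem_union_left _ (mem_image.2 ⟨u, hu, h⟩))
  · have h1 : #(Lᶜ.image g) ≤ #Lᶜ := card_image_le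
    have h2 := card_add_card_compl (Lᶜ.image g ∪ (B.neighborFinset y \ Y))
    have h3 := card_union_le (Lᶜ.image g) (B.neighborFinset y \ Y)
    rw [compl_compl]
    omega
  · rw [filter_false_of_mem fun x hx => hbad u hu x hx, card_empty]
  · rw [filter_false_of_mem fun u hu => hbad u (mem_compl.1 hu) x hx, card_empty]
    omega

/-- A sparse graph packs with a graph of bounded degree, provided a vertex of small degree in the
latter leaves enough room. -/
theorem exists_packing_of_sparse (hk : 1 ≤ k) (ht : 1 ≤ t)
    (hn : 28 * t ^ 2 * k ^ 3 ≤ Fintype.card V) (hΔ : Δ + 2 ≤ t * (k + 1))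
    (hconn : G.Connected) (hsum : 12 * ∑ v, G.degree v ≤ 25 * Fintype.card V)
    (hB : ∀ x, B.degree x ≤ Δ) (hW : Fintype.card V ≤ Fintype.card W)
    (y : W) (hy : B.degree y < k)
    (hroom : ∀ v, ∃ J : Finset V, (∀ u ∈ J, ∀ w ∈ J, ¬ G.Adj u w) ∧
      (∀ u ∈ J, u ≠ v ∧ ¬ G.Adj v u) ∧ Fintype.card V + B.degree y ≤ Fintype.card W + #J) :
    ∃ g : V → W, Function.Injective g ∧ ∀ u v, G.Adj u v → ¬ B.Adj (g u) (g v) := by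
  have h28 := (sq_degree_bound_le hk ht hn hΔ).2.2.1
  have hnt : Nontrivial V := Fintype.one_lt_card_iff_nontrivial.1 (by omega)
  have hpos : ∀ v, 1 ≤ G.degree v := fun v => hconn.preconnected.degree_pos_of_nontrivial v
  have hleaf : ∀ u v, G.degree u = 1 → G.degree v = 1 → ¬ G.Adj u v := by
    intro u v hu hv huv
    obtain ⟨w, hw⟩ : ∃ w, w ∉ ({u, v} : Finset V) := by
      by_contra! hall
      have h1 := card_le_card (show univ ⊆ ({u, v} : Finset V) from fun w _ => hall w)
      have h2 := card_le_two (a := u) (b := v)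
      rw [card_univ] at h1
      omega
    obtain ⟨p⟩ := hconn.preconnected u w
    obtain ⟨d, -, hd1, hd2⟩ := p.exists_boundary_dart {u, v} (by simp) (by simpa using hw)
    obtain ⟨a, ha⟩ := (G.degree_eq_one_iff_existsUnique_adj).1 hu
    obtain ⟨b, hb⟩ := (G.degree_eq_one_iff_existsUnique_adj).1 hv
    have hadj := d.adj
    rcases hd1 with h | h
    · rw [h] at hadj
      exact hd2 (Or.inr ((ha.2 _ hadj).trans (ha.2 _ huv).symm))
    · rw [Set.mem_singleton_iff.1 h] at hadj
      exact hd2 (Or.inl ((hb.2 _ hadj).trans (hb.2 _ huv.symm).symm))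
  by_cases hL : #{v | G.degree v = 1} < Δ * Δ ∨ #{v | G.degree v = 1} < 5 * Δ + k
  · exact exists_packing_of_few_leaves hk ht hn hΔ hpos hsum hB hW hL
  push Not at hL
  obtain ⟨v₁, -, hmax⟩ := exists_max_image univ
    (fun v => #(G.neighborFinset v ∩ ({v | G.degree v = 1} : Finset V))) univ_nonempty
  by_cases hspread : #(G.neighborFinset v₁ ∩ ({v | G.degree v = 1} : Finset V)) + 3 * Δ ≤
      #{v | G.degree v = 1}
  · refine exists_packing_of_spread_leaves hk ht hn hΔ hpos hsum hB hW hleaf (by omega) hL.1 v₁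
      (fun h1 => ?_) (fun v => hmax v (mem_univ _)) hspread
    obtain ⟨u, hu⟩ : ({v | G.degree v = 1} : Finset V).Nonempty := by
      rw [← card_pos]; omega
    obtain ⟨p, hp⟩ := (G.degree_pos_iff_exists_adj u).1 (hpos u)
    have h2 : 0 < #(G.neighborFinset p ∩ ({v | G.degree v = 1} : Finset V)) :=
      card_pos.2 ⟨u, mem_inter.2 ⟨by simpa using hp.symm, hu⟩⟩
    obtain ⟨w, hw⟩ := card_pos.1 (h2.trans_le (hmax p (mem_univ _)))
    simp only [mem_inter, SimpleGraph.mem_neighborFinset, mem_filter, mem_univ, true_and] at hw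
    exact hleaf v₁ w h1 hw.2 hw.1
  · obtain ⟨J, hJ, hJv, hJc⟩ := hroom v₁
    exact exists_packing_of_concentrated_leaves hk ht hn hΔ hpos hsum hB hW v₁ (by omega) J hJ hJv
      y hy hJc

end Cases

/-! ### Disjoint stars in B. -/

section Stars

variable {W : Type*} {B : SimpleGraph W} {k t : ℕ}

/-- A star disjoint from `t` disjoint stars yields `t + 1` disjoint stars. -/
theorem copies_succ_star_isContained (c : SimpleGraph.Copy (copies t (star k)) B) (x : W)
    (T : Finset W) (hT : k ≤ #T) (hxT : ∀ y ∈ T, B.Adj x y) (hx : ∀ p, c p ≠ x)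
    (hcT : ∀ p, c p ∉ T) : (copies (t + 1) (star k)).IsContained B := by
  obtain ⟨T', hT'T, hT'⟩ := exists_subset_card_eq hT
  let e : Fin k ≃ T' := (T'.equivFinOfCardEq hT').symm
  have heT : ∀ j, (e j : W) ∈ T := fun j => hT'T (e j).2
  have hex : ∀ j, (e j : W) ≠ x := fun j h => B.loopless.irrefl x (h ▸ hxT _ (heT j))
  let F : Fin (t + 1) → Fin 1 ⊕ Fin k → W :=
    Fin.cases (Sum.elim (fun _ => x) fun j => e j) fun i s => c (i, s)
  have hF0 : ∀ s, F 0 s = Sum.elim (fun _ => x) (fun j => (e j : W)) s := fun _ => rfl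
  have hFs : ∀ i s, F (Fin.succ i) s = c (i, s) := fun _ _ => rfl
  have hne : ∀ i s s', F 0 s ≠ F (Fin.succ i) s' := by
    intro i s s' h
    rw [hF0, hFs] at h
    rcases s with s | s
    · exact hx _ h.symm
    · exact hcT (i, s') (h ▸ heT s)
  refine ⟨⟨⟨fun p => F p.1 p.2, ?_⟩, ?_⟩⟩
  · rintro ⟨i, s⟩ ⟨j, s'⟩ ⟨rfl, h⟩
    induction i using Fin.cases with
    | zero =>
      simp only [hF0]
      rcases s with s | s <;> rcases s' with s' | s'
      · simp [star] at h
      · exact hxT _ (heT _)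
      · exact (hxT _ (heT _)).symm
      · simp [star] at h
    | succ i =>
      simp only [hFs]
      exact c.toHom.map_adj ⟨rfl, h⟩
  · rintro ⟨i, s⟩ ⟨j, s'⟩ h
    change F i s = F j s' at h
    induction i using Fin.cases with
    | zero =>
      induction j using Fin.cases with
      | zero =>
        simp only [hF0] at h
        rcases s with s | s <;> rcases s' with s' | s'
        · rw [Subsingleton.elim s s']
        · exact absurd h.symm (hex _)
        · exact absurd h (hex _)
        · rw [e.injective (Subtype.ext h)]
      | succ j => exact absurd h (hne _ _ _)
    | succ i =>
      induction j using Fin.cases with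
      | zero => exact absurd h.symm (hne _ _ _)
      | succ j =>
        rw [hFs, hFs] at h
        obtain ⟨h₁, h₂⟩ := Prod.mk.inj (c.injective h)
        rw [h₁, h₂]

theorem card_image_copy_star [DecidableEq W] (c : SimpleGraph.Copy (copies t (star k)) B) :
    #(univ.image fun p => c p) = t * (k + 1) := by
  rw [card_image_of_injective (f := fun p => c p) _ c.injective]
  simp [add_comm]

variable [Fintype W] [DecidableEq W] [DecidableRel B.Adj]

theorem copies_star_isContained
    (h : ∀ U : Finset W, #U + (k + 1) ≤ t * (k + 1) → ∃ x ∉ U, k ≤ #(B.neighborFinset x \ U)) :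
    (copies t (star k)).IsContained B := by
  induction t with
  | zero => exact SimpleGraph.IsContained.of_isEmpty
  | succ t ih =>
    rw [Nat.succ_mul] at h
    obtain ⟨c⟩ := ih fun U hU => h U (by omega)
    obtain ⟨x, hxU, hx⟩ := h (univ.image fun p => c p) (by rw [card_image_copy_star])
    refine copies_succ_star_isContained c x _ hx (fun y hy => ?_) (fun p hp => hxU ?_) fun p hp => ?_
    · simpa using (mem_sdiff.1 hy).1
    · exact mem_image.2 ⟨p, mem_univ _, hp⟩
    · exact (mem_sdiff.1 hp).2 (mem_image_of_mem _ (mem_univ _))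

/-- If all degrees were at least `k` and the greedy choice of stars stalled at a used set `U`, every
vertex outside `U` would have a neighbour in `U`, so closed neighbourhoods of `U` would cover a set
too large for them. -/
theorem exists_degree_lt_of_not_isContained {Δ : ℕ} (hB : ∀ x, B.degree x ≤ Δ)
    (hW : (t - 1) * (k + 1) * (Δ + 1) < Fintype.card W)
    (h : ¬ (copies t (star k)).IsContained B) : ∃ y, B.degree y < k := by
  by_contra! hdeg
  refine h (copies_star_isContained fun U hU => ?_)
  by_contra! hU'
  have hUcard : #U ≤ (t - 1) * (k + 1) := by
    rw [Nat.sub_mul]; omega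
  have hcov : (univ : Finset W) ⊆ U.biUnion fun u => insert u (B.neighborFinset u) := by
    intro y _
    rw [mem_biUnion]
    by_cases hy : y ∈ U
    · exact ⟨y, hy, mem_insert_self _ _⟩
    · by_contra! hall
      have h1 : B.neighborFinset y \ U = B.neighborFinset y := by
        refine sdiff_eq_self_of_disjoint (disjoint_left.2 fun u hu huU => hall u huU ?_)
        exact mem_insert_of_mem (by simpa using ((B.mem_neighborFinset _ _).1 hu).symm)
      have h2 := hU' y hy
      rw [h1] at h2
      exact absurd (hdeg y) (not_le.2 h2)
  have h1 := card_le_card hcov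
  have h2 : #(U.biUnion fun u => insert u (B.neighborFinset u)) ≤ #U * (Δ + 1) :=
    card_biUnion_le_card_mul _ _ _ fun u _ =>
      (card_insert_le _ _).trans (Nat.succ_le_succ (hB u))
  have h3 := Nat.mul_le_mul_right (Δ + 1) hUcard
  rw [card_univ] at h1
  omega

end Stars

/-! ### The upper bound, by induction on t. -/

theorem exists_independent_alphaPrime {V : Type*} [Finite V] (G : SimpleGraph V) (v : V) :
    ∃ J : Finset V, (∀ u ∈ J, ∀ w ∈ J, ¬ G.Adj u w) ∧ (∀ u ∈ J, u ≠ v ∧ ¬ G.Adj v u) ∧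
      alphaPrime G ≤ #J := by
  classical
  obtain ⟨s, hs⟩ := (deleteClosedNbhd G v).exists_isNIndepSet_indepNum
  refine ⟨s.map (Function.Embedding.subtype _), ?_, ?_, ?_⟩
  · intro u' hu' w' hw' huw
    obtain ⟨u, hu, rfl⟩ := mem_map.1 hu'
    obtain ⟨w, hw, rfl⟩ := mem_map.1 hw'
    exact hs.isIndepSet hu hw (fun h => G.loopless.irrefl _ (h ▸ huw)) huw
  · intro u hu
    obtain ⟨u, -, rfl⟩ := mem_map.1 hu
    have := u.2
    simp only [Set.mem_compl_iff, Set.mem_insert_iff, SimpleGraph.mem_neighborSet, not_or] at this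
    exact this
  · rw [card_map, hs.card_eq]
    exact ciInf_le (OrderBot.bddBelow _) v

section UpperBound

variable {V : Type*} [Fintype V] {G : SimpleGraph V} {k : ℕ}

theorem copies_star_isContained_or_exists_packing [DecidableRel G.Adj] (hk : 1 ≤ k)
    (hconn : G.Connected) (hsum : 12 * ∑ v, G.degree v ≤ 25 * Fintype.card V) (t : ℕ) :
    ∀ (W : Type) [Fintype W] (B : SimpleGraph W), 28 * t ^ 2 * k ^ 3 ≤ Fintype.card V →
      Fintype.card V + t ≤ Fintype.card W + 1 →
      Fintype.card V + k + t ≤ Fintype.card W + alphaPrime G + 2 →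
      (copies t (star k)).IsContained B ∨
        ∃ g : V → W, Function.Injective g ∧ ∀ u v, G.Adj u v → ¬ B.Adj (g u) (g v) := by
  classical
  induction t with
  | zero => exact fun W _ B _ _ _ => Or.inl SimpleGraph.IsContained.of_isEmpty
  | succ t ih =>
    intro W _ B hn hW hα
    -- The threshold is `t(k + 1) + k`: `t` stars use at most `t(k + 1)` neighbours of `x` and leave
    -- `k`. Deleting `x` lowers `t` and the order of `B` by one each, preserving both size
    -- hypotheses.
    by_cases hx : ∃ x, (t + 1) * (k + 1) ≤ B.degree x + 1
    · obtain ⟨x, hx⟩ := hx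
      have hcard : Fintype.card {y // y ≠ x} = Fintype.card W - 1 := by
        simp [Fintype.card_subtype_compl]
      have hWpos : 0 < Fintype.card W := Fintype.card_pos_iff.2 ⟨x⟩
      have hn' : 28 * t ^ 2 * k ^ 3 ≤ Fintype.card V := le_trans (by gcongr; omega) hn
      rcases ih {y // y ≠ x} (B.comap Subtype.val) hn' (by omega) (by omega) with hc | ⟨g, hg, hgB⟩
      · left
        obtain ⟨c⟩ := hc
        let c' : SimpleGraph.Copy (copies t (star k)) B :=
          ⟨⟨fun p => (c p : W), fun h => c.toHom.map_adj h⟩,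
            fun p q h => c.injective (Subtype.ext h)⟩
        refine copies_succ_star_isContained c' x
          (B.neighborFinset x \ univ.image fun p => c' p) ?_ (fun y hy => ?_)
          (fun p => (c p).2) fun p hp => ?_
        · have h1 := le_card_sdiff (univ.image fun p => c' p) (B.neighborFinset x)
          rw [card_image_copy_star, SimpleGraph.card_neighborFinset_eq_degree] at h1
          rw [Nat.succ_mul] at hx
          omega
        · simpa using (mem_sdiff.1 hy).1
        · exact (mem_sdiff.1 hp).2 (mem_image_of_mem _ (mem_univ _))
      · exact Or.inr ⟨fun v => g v, Subtype.val_injective.comp hg, hgB⟩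
    · push Not at hx
      refine or_iff_not_imp_left.2 fun hstars => ?_
      have h2 : 2 ≤ (t + 1) * (k + 1) := by nlinarith
      have hΔ : (t + 1) * (k + 1) - 2 + 2 ≤ (t + 1) * (k + 1) := by omega
      have hB : ∀ x, B.degree x ≤ (t + 1) * (k + 1) - 2 := fun x => by
        have := hx x
        omega
      have h28 := (sq_degree_bound_le hk (by omega) hn hΔ).2.2.2
      obtain ⟨y, hy⟩ := exists_degree_lt_of_not_isContained hB (by omega) hstars
      refine exists_packing_of_sparse hk (by omega) hn hΔ hconn hsum hB (by omega) y hy fun v => ?_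
      obtain ⟨J, hJ, hJv, hJc⟩ := exists_independent_alphaPrime G v
      exact ⟨J, hJ, hJv, by omega⟩

theorem isContained_or_copies_star_isContained_compl [DecidableRel G.Adj] {t m : ℕ} (hk : 1 ≤ k)
    (hconn : G.Connected) (hsum : 12 * ∑ v, G.degree v ≤ 25 * Fintype.card V)
    (hn : 28 * t ^ 2 * k ^ 3 ≤ Fintype.card V) (hm : Fintype.card V + t ≤ m + 1)
    (hα : Fintype.card V + k + t ≤ m + alphaPrime G + 2) (F : SimpleGraph (Fin m)) :
    G.IsContained F ∨ (copies t (star k)).IsContained Fᶜ := by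
  rcases copies_star_isContained_or_exists_packing hk hconn hsum t (Fin m) Fᶜ hn (by simpa using hm)
    (by simpa using hα) with h | ⟨g, hg, hgF⟩
  · exact Or.inr h
  · refine Or.inl ⟨⟨⟨g, fun {u v} huv => ?_⟩, hg⟩⟩
    have := hgF u v huv
    rw [SimpleGraph.compl_adj, not_and, not_not] at this
    exact this fun h => huv.ne (hg h)

end UpperBound

/-! ### The lower bound construction. -/

/-- The disjoint union of two cliques, on the elements less than `a` and on the other elements. -/
def twoCliques (a m : ℕ) : SimpleGraph (Fin m) where
  Adj x y := x ≠ y ∧ ((x : ℕ) < a ↔ (y : ℕ) < a)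
  symm := ⟨fun _ _ h => ⟨h.1.symm, h.2.symm⟩⟩
  loopless := ⟨fun _ h => h.1 rfl⟩

theorem not_isContained_twoCliques {V : Type*} [Fintype V] {G : SimpleGraph V}
    (hconn : G.Connected) {a m : ℕ} (ha : a < Fintype.card V) (hm : m < a + Fintype.card V) :
    ¬ G.IsContained (twoCliques a m) := by
  rintro ⟨c⟩
  have hadj : ∀ u v, G.Adj u v → ((c u : ℕ) < a ↔ (c v : ℕ) < a) := fun u v h =>
    (c.toHom.map_adj h).2
  have hconst : ∀ u v, (c u : ℕ) < a ↔ (c v : ℕ) < a := by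
    intro u v
    obtain ⟨p⟩ := hconn.preconnected u v
    induction p with
    | nil => rfl
    | cons h _ ih => exact (hadj _ _ h).trans ih
  have hinj : Function.Injective fun v => (c v : ℕ) := Fin.val_injective.comp c.injective
  obtain ⟨v₀⟩ := hconn.nonempty
  by_cases h₀ : (c v₀ : ℕ) < a
  · have h1 := card_le_card_of_injOn (s := univ) (t := range a) (fun v => (c v : ℕ))
      (fun v _ => by simpa using (hconst v v₀).2 h₀) hinj.injOn
    rw [card_univ, card_range] at h1
    omega
  · have h1 := card_le_card_of_injOn (s := univ) (t := Ico a m) (fun v => (c v : ℕ))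
      (fun v _ => by
        have := mt (hconst v v₀).1 h₀
        simp only [coe_Ico, Set.mem_Ico]
        exact ⟨by omega, (c v).2⟩) hinj.injOn
    rw [card_univ, Nat.card_Ico] at h1
    omega

/-- The complement is bipartite, so each star has a vertex in the second part, which has fewer than
`t` vertices. -/
theorem not_copies_star_isContained_compl_twoCliques {a k m t : ℕ} (hk : 1 ≤ k)
    (ht : 1 ≤ t) (hm : m < a + t) : ¬ (copies t (star k)).IsContained (twoCliques a m)ᶜ := by
  rintro ⟨c⟩
  have hex : ∀ i : Fin t, ∃ s, a ≤ (c (i, s) : ℕ) := by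
    intro i
    by_contra! h
    have hadj : (twoCliques a m)ᶜ.Adj (c (i, Sum.inl 0)) (c (i, Sum.inr ⟨0, hk⟩)) :=
      c.toHom.map_adj ⟨rfl, by simp [star]⟩
    rw [SimpleGraph.compl_adj] at hadj
    exact hadj.2 ⟨hadj.1, iff_of_true (h _) (h _)⟩
  choose s hs using hex
  have h1 := card_le_card_of_injOn (s := univ) (t := Ico a m) (fun i => (c (i, s i) : ℕ))
    (fun i _ => by
      simp only [coe_Ico, Set.mem_Ico]
      exact ⟨hs i, (c (i, s i)).2⟩)
    fun i _ j _ h => congrArg Prod.fst (c.injective (Fin.ext h))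
  rw [card_univ, Nat.card_Ico, Fintype.card_fin] at h1
  omega

end SparseRamsey

/-! ### The main theorem. -/

theorem mainTheorem4 {V : Type*} [Fintype V] (G : SimpleGraph V) (n k t : ℕ)
    (hk : 1 ≤ k) (ht : 1 ≤ t) (hn : 28 * t ^ 2 * k ^ 3 ≤ n)
    (hcard : Fintype.card V = n) (hconn : G.Connected)
    (hedges : (G.edgeSet.ncard : ℝ) ≤
      (n : ℝ) * (1 + 1 / (21 * (t : ℝ) * (k : ℝ) - 3 * (k : ℝ) + 6))) :
    ∃ r : ℕ,
      SparseRamsey.IsRamseyNumber G (SparseRamsey.copies t (SparseRamsey.star k)) r ∧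
      (r : ℤ) ≤ max (n : ℤ) ((n : ℤ) + k - 1 - SparseRamsey.alphaPrime G) + t - 1 ∧
      ((k : ℤ) - 1 ≤ SparseRamsey.alphaPrime G → (r : ℤ) = (n : ℤ) + t - 1) := by
  classical
  subst hcard
  have htn : t ≤ Fintype.card V ∧ 1 ≤ Fintype.card V := by
    have h1 : 1 ≤ k ^ 3 := Nat.one_le_pow _ _ hk
    have h2 : t ≤ t ^ 2 := Nat.le_self_pow two_ne_zero t
    have h3 : 28 * t ^ 2 ≤ 28 * t ^ 2 * k ^ 3 := Nat.le_mul_of_pos_right _ h1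
    omega
  have hsum : 12 * ∑ v, G.degree v ≤ 25 * Fintype.card V := by
    rw [G.sum_degrees_eq_twice_card_edges]
    have hk' : (1 : ℝ) ≤ k := by exact_mod_cast hk
    have ht' : (1 : ℝ) ≤ t := by exact_mod_cast ht
    have h1 : (24 : ℝ) ≤ 21 * t * k - 3 * k + 6 := by nlinarith
    have h2 : 1 / (21 * (t : ℝ) * k - 3 * k + 6) ≤ 1 / 24 :=
      one_div_le_one_div_of_le (by norm_num) h1
    have h3 : (G.edgeSet.ncard : ℝ) ≤ Fintype.card V * (1 + 1 / 24) :=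
      hedges.trans (by gcongr)
    have h4 : G.edgeSet.ncard = G.edgeFinset.card := Set.ncard_eq_toFinset_card' _
    rw [h4] at h3
    have h5 : ((12 * (2 * G.edgeFinset.card) : ℕ) : ℝ) ≤ ((25 * Fintype.card V : ℕ) : ℝ) := by
      push_cast
      linarith
    exact_mod_cast h5
  let S : Set ℕ := {m : ℕ | 0 < m ∧ ∀ F : SimpleGraph (Fin m), G.IsContained F ∨
    (SparseRamsey.copies t (SparseRamsey.star k)).IsContained Fᶜ}
  -- Truncated subtraction is harmless: the maximum with n absorbs it, and `t ≥ 1`.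
  have hupper : max (Fintype.card V) (Fintype.card V + k - 1 - SparseRamsey.alphaPrime G) + t - 1
      ∈ S :=
    ⟨by omega, SparseRamsey.isContained_or_copies_star_isContained_compl hk hconn hsum hn (by omega)
      (by omega)⟩
  have hlower : ∀ m ∈ S, Fintype.card V + t ≤ m + 1 := by
    intro m hm
    by_contra! hlt
    rcases hm.2 (SparseRamsey.twoCliques (Fintype.card V - 1) m) with h | h
    · exact SparseRamsey.not_isContained_twoCliques hconn (by omega) (by omega) h
    · exact SparseRamsey.not_copies_star_isContained_compl_twoCliques hk ht (by omega) h
  have hle := Nat.sInf_le hupper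
  have hge := hlower _ (Nat.sInf_mem ⟨_, hupper⟩)
  refine ⟨sInf S, ⟨Nat.sInf_mem ⟨_, hupper⟩, fun m hm => Nat.sInf_le hm⟩, ?_, fun hα => ?_⟩
  · omega
  · omega
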